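/- Let $S^1=\Delta[1]/\partial\Delta[1]$ be the simplicial circle and let $F(S^1)$ be Milnor's construction on it, that is, the simplicial group which in degree $m$ is the free group on the set $(S^1)_m$ modulo the relation that the base point is $1$. For $0\le i\le m+1$ let $x_i\in F(S^1)_m$ be the class of the $m$-simplex of $\Delta[1]$ that takes $i$ times the value $0$ and $m+1-i$ times the value $1$ (so $x_0=x_{m+1}=1$), and put $y_{k}=x_{k+1}x_{k+2}^{-1}$ for $-1\le k\le m-1$; then $F(S^1)_m$ is free on $y_0,\dots,y_{m-1}$, and $y_{-1}=(y_0\cdots y_{m-1})^{-1}$. The braid group $B_{m+1}$ with Artin generators $\sigma_{-1},\sigma_0,\dots,\sigma_{m-2}$ acts on $F(S^1)_m$ by automorphisms with $$\sigma_k(y_k)=y_{k+1},\qquad \sigma_k(y_{k+1})=y_{k+1}^{-1}y_ky_{k+1},\qquad \sigma_k(y_j)=y_j\ \ (j\ne k,k+1).$$ For a simplicial group $G$ put $\mathcal Z_m(G)=\{x\in G_m\mid d_jx=1\text{ for all }j\}$, $\mathcal B_m(G)=\{d_0x\mid x\in G_{m+1},\ d_jx=1\text{ for all }j>0\}$ and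 $\pi_m(G)=\mathcal Z_m(G)/\mathcal B_m(G)$. The subgroup $\mathcal B_m(F(S^1))$ is normal in $F(S^1)_m$ and invariant under $B_{m+1}$, so $B_{m+1}$ acts on $F(S^1)_m/\mathcal B_m(F(S^1))$. Let $K_m$ denote the pure braid group, the kernel of $B_m\to\Sigma_m$. Let $n\ge 2$. Consider the action of $B_{n+2}$ on $F(S^1)_{n+1}/\mathcal B_{n+1}(F(S^1))$ and of its subgroup $B_{n+1}$ generated by $\sigma_0,\dots,\sigma_{n-1}$. The canonical map $\pi_{n+1}(F(S^1))\to F(S^1)_{n+1}/\mathcal B_{n+1}(F(S^1))$ is injective, and, regarding $\pi_{n+1}(F(S^1))$ as a subgroup through it: 1. the fixed set of $K_{n+1}$ is $\mathbb Z\oplus\pi_{n+1}(F(S^1))$; more precisely, $(k,z)\mapsto y_{-1}^{\,k}z$ is a group isomorphism of $\mathbb Z\times\pi_{n+1}(F(S^1))$ onto the fixed set; 2. the fixed set of $K_{n+2}$ is exactly $\pi_{n+1}(F(S^1))$. -/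

import Mathlib

/-! ### Braid groups -/

/-- The Artin relations of the braid group on `m` strands, in the generators
`σ₀, …, σ_{m-2}`. -/
inductive BraidRel (m : ℕ) : FreeGroup (Fin (m - 1)) → Prop
  | braid (i j : Fin (m - 1)) (h : (i : ℕ) + 1 = j) :
      BraidRel m (FreeGroup.of i * FreeGroup.of j * FreeGroup.of i *
        (FreeGroup.of j * FreeGroup.of i * FreeGroup.of j)⁻¹)
  | comm (i j : Fin (m - 1)) (h : (i : ℕ) + 2 ≤ j) :
      BraidRel m (FreeGroup.of i * FreeGroup.of j * (FreeGroup.of j * FreeGroup.of i)⁻¹)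

/-- The Artin braid group on `m` strands. -/
abbrev BraidGroup (m : ℕ) : Type := PresentedGroup {r | BraidRel m r}

namespace BraidGroup

/-- A homomorphism out of the braid group from images of the generators satisfying the
Artin relations. -/
def lift {m : ℕ} {H : Type*} [Group H] (f : Fin (m - 1) → H)
    (hb : ∀ i j : Fin (m - 1), (i : ℕ) + 1 = j → f i * f j * f i = f j * f i * f j)
    (hc : ∀ i j : Fin (m - 1), (i : ℕ) + 2 ≤ j → f i * f j = f j * f i) :
    BraidGroup m →* H :=
  PresentedGroup.toGroup (f := f) (by
    rintro r (⟨i, j, h⟩ | ⟨i, j, h⟩)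
    · simp only [map_mul, map_inv, FreeGroup.lift_apply_of, mul_inv_eq_one]
      exact hb i j h
    · simp only [map_mul, map_inv, FreeGroup.lift_apply_of, mul_inv_eq_one]
      exact hc i j h)

/-- The `i`-th Artin generator. -/
def gen {m : ℕ} (i : Fin (m - 1)) : BraidGroup m := PresentedGroup.of i

@[simp]
lemma lift_gen {m : ℕ} {H : Type*} [Group H] (f : Fin (m - 1) → H) (hb hc) (i : Fin (m - 1)) :
    lift f hb hc (gen i) = f i :=
  PresentedGroup.toGroup.of _

lemma gen_braid {m : ℕ} (i j : Fin (m - 1)) (h : (i : ℕ) + 1 = j) :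
    gen i * gen j * gen i = gen j * gen i * gen j := by
  have := PresentedGroup.one_of_mem (rels := {r | BraidRel m r}) (BraidRel.braid i j h)
  simp only [map_mul, map_inv, mul_inv_eq_one] at this
  exact this

lemma gen_comm {m : ℕ} (i j : Fin (m - 1)) (h : (i : ℕ) + 2 ≤ j) :
    gen i * gen j = gen j * gen i := by
  have := PresentedGroup.one_of_mem (rels := {r | BraidRel m r}) (BraidRel.comm i j h)
  simp only [map_mul, map_inv, mul_inv_eq_one] at this
  exact this

/-- The canonical homomorphism `B_m → Σ_m`; the `i`-th generator goes to the transposition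
`(i, i + 1)`. -/
def toPerm (m : ℕ) : BraidGroup m →* Equiv.Perm (Fin m) :=
  lift (fun i => Equiv.swap ⟨i, by omega⟩ ⟨i + 1, by omega⟩)
    (by
      intro i j h
      ext k
      simp only [Equiv.Perm.mul_apply, Equiv.swap_apply_def, Fin.ext_iff]
      grind)
    (by
      intro i j h
      ext k
      simp only [Equiv.Perm.mul_apply, Equiv.swap_apply_def, Fin.ext_iff]
      grind)

/-- The pure braid group `K_m`. -/
def pure (m : ℕ) : Subgroup (BraidGroup m) := (toPerm m).ker

/-- The homomorphism `B_m → B_{m+1}` onto the subgroup generated by all the generators except the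
first one. -/
def shift (m : ℕ) : BraidGroup m →* BraidGroup (m + 1) :=
  lift (fun i => gen ⟨i + 1, by omega⟩)
    (fun _ _ h => gen_braid _ _ (by simpa using h))
    (fun _ _ h => gen_comm _ _ (by simp only; omega))

end BraidGroup

/-! ### Simplicial groups: cycles, boundaries, homotopy groups -/

section

open CategoryTheory Opposite

namespace SimplicialGroup

variable (G : SimplicialObject GrpCat.{0})

/-- `NG_n`: the simplices all of whose faces `d_j` with `j > 0` are trivial. -/
def moore : (n : ℕ) → Subgroup (G.obj (op (.mk n)))
  | 0 => ⊤
  | n + 1 => ⨅ j : Fin (n + 1), (G.δ j.succ).hom.ker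

/-- `𝒵_n(G)`: the simplices all of whose faces are trivial. -/
def cycles : (n : ℕ) → Subgroup (G.obj (op (.mk n)))
  | 0 => ⊤
  | n + 1 => ⨅ j : Fin (n + 2), (G.δ j).hom.ker

/-- `ℬ_n(G) = d_0(NG_{n+1})`. -/
def boundaries (n : ℕ) : Subgroup (G.obj (op (.mk n))) := (moore G (n + 1)).map (G.δ 0).hom

lemma mem_moore_succ {n : ℕ} (x : G.obj (op (.mk (n + 1)))) :
    x ∈ moore G (n + 1) ↔ ∀ j : Fin (n + 1), G.δ j.succ x = 1 := by
  simp [moore, Subgroup.mem_iInf, MonoidHom.mem_ker]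

instance boundaries_normal (n : ℕ) : (boundaries G n).Normal := by
  have : (moore G (n + 1)).Normal := Subgroup.normal_iInf_normal fun j => inferInstance
  refine this.map _ fun x => ⟨G.σ 0 x, ?_⟩
  have := ConcreteCategory.congr_hom (G.δ_comp_σ_self (i := (0 : Fin (n + 1)))) x
  simpa using this

/-- `π_n(G) = 𝒵_n(G) / ℬ_n(G)`. -/
abbrev homotopyGroup (n : ℕ) : Type :=
  cycles G n ⧸ (boundaries G n).subgroupOf (cycles G n)

/-- The quotient `G_n / ℬ_n(G)`. -/
abbrev modBoundaries (n : ℕ) : Type := G.obj (op (.mk n)) ⧸ boundaries G n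

/-- The inclusion `π_n(G) = 𝒵_n(G) / ℬ_n(G) → G_n / ℬ_n(G)`. -/
def homotopyIncl (n : ℕ) : homotopyGroup G n →* modBoundaries G n :=
  QuotientGroup.map _ _ (cycles G n).subtype le_rfl

end SimplicialGroup

/-! ### Milnor's construction on the simplicial circle -/

open Simplicial

/-- The quotient simplicial set `X / A`: all the simplices of `A` are identified in each degree. -/
def SSet.collapse (X : SSet.{0}) (A : X.Subcomplex) : SSet.{0} where
  obj n := Quot fun a b : X.obj n => a ∈ A.obj n ∧ b ∈ A.obj n
  map f := ↾(Quot.map (X.map f) fun _ _ h => ⟨A.map f h.1, A.map f h.2⟩)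
  map_id n := by
    ext ⟨a⟩
    exact congrArg (Quot.mk _) (by simp)
  map_comp f g := by
    ext ⟨a⟩
    exact congrArg (Quot.mk _) (by simp)

/-- Milnor's construction on a simplicial set `X` pointed at the vertex `pt`: in degree `n` it is
the free group on `X_n` modulo the relation that the (degenerate) base point is `1`. -/
def milnorF (X : SSet.{0}) (pt : X _⦋0⦌) : SimplicialObject GrpCat.{0} where
  obj n := GrpCat.of (FreeGroup (X.obj n) ⧸
    Subgroup.normalClosure {FreeGroup.of (X.map (SimplexCategory.const n.unop ⦋0⦌ 0).op pt)})
  map {n m} f := GrpCat.ofHom (QuotientGroup.map _ _ (FreeGroup.map (X.map f)) (by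
    refine Subgroup.normalClosure_le_normal ?_
    rintro _ rfl
    refine Subgroup.subset_normalClosure ?_
    have h : (SimplexCategory.const n.unop ⦋0⦌ 0).op ≫ f =
        (SimplexCategory.const m.unop ⦋0⦌ 0).op := Quiver.Hom.unop_inj (by ext; rfl)
    rw [← h]
    simp))
  map_id n := by
    ext x
    simp
  map_comp f g := by
    ext x
    simp

/-- The simplicial circle `S¹ = Δ[1] / ∂Δ[1]`. -/
def simplicialCircle : SSet.{0} := SSet.collapse Δ[1] ∂Δ[1]

/-- The base point of the simplicial circle. -/
def simplicialCircle.pt : simplicialCircle _⦋0⦌ := Quot.mk _ (SSet.stdSimplex.obj₀Equiv.symm 0)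

/-- `F(S¹)`: Milnor's construction on the simplicial circle. -/
def FS1 : SimplicialObject GrpCat.{0} := milnorF simplicialCircle simplicialCircle.pt

namespace FS1

/-- The generator of `F(S¹)_m` given by the simplex of `Δ[1]` that takes `i` times the value `0`
and `m + 1 - i` times the value `1`. It is `1` for `i = 0` and for `i = m + 1`, and `F(S¹)_m` is
free on the others. -/
def x {m : ℕ} (i : Fin (m + 2)) : FS1 _⦋m⦌ :=
  QuotientGroup.mk (FreeGroup.of (Quot.mk _ (SSet.stdSimplex.objMk₁ i)))

lemma objMk₁_mem_boundary {m : ℕ} (i : Fin (m + 2)) :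
    SSet.stdSimplex.objMk₁ i ∈ (SSet.boundary.{0} 1).obj (op ⦋m⦌) ↔ i = 0 ∨ i = Fin.last _ := by
  rw [SSet.mem_boundary_iff_notMem_range]
  constructor
  · rintro ⟨j, hj⟩
    by_contra! h
    apply hj
    have h0 : (i : ℕ) ≠ 0 := fun h' => h.1 (Fin.ext h')
    have h1 : (i : ℕ) ≠ m + 1 := fun h' => h.2 (Fin.ext h')
    fin_cases j
    · exact ⟨0, SSet.stdSimplex.objMk₁_of_castSucc_lt _ _ (by
        rw [Fin.lt_def, Fin.val_castSucc, Fin.val_zero]; omega)⟩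
    · exact ⟨Fin.last _, SSet.stdSimplex.objMk₁_of_le_castSucc _ _ (by simp [Fin.le_def]; omega)⟩
  · rintro (rfl | rfl)
    · refine ⟨0, ?_⟩
      rintro ⟨k, hk⟩
      simp [SSet.stdSimplex.objMk₁_apply_eq_zero_iff] at hk
    · refine ⟨1, ?_⟩
      rintro ⟨k, hk⟩
      rw [SSet.stdSimplex.objMk₁_apply_eq_one_iff] at hk
      simp [Fin.le_def] at hk
      omega

lemma x_eq_one {m : ℕ} (i : Fin (m + 2)) (h : i = 0 ∨ i = Fin.last _) : x i = 1 := by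
  refine (QuotientGroup.eq_one_iff _).2 (Subgroup.subset_normalClosure ?_)
  refine congrArg FreeGroup.of (Quot.sound ⟨(objMk₁_mem_boundary i).2 h, ?_⟩)
  refine (SSet.boundary.{0} 1).map _ ?_
  rw [SSet.boundary_obj_eq_univ 0 1]
  trivial

lemma δ_x {m : ℕ} (j : Fin (m + 2)) (i : Fin (m + 3)) : FS1.δ j (x i) = x (j.predAbove i) := by
  refine congrArg (fun t => QuotientGroup.mk (FreeGroup.of (Quot.mk _ t))) ?_
  rcases le_or_gt i j.castSucc with h | h
  · rw [Fin.predAbove_of_le_castSucc _ _ h]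
    exact SSet.stdSimplex.δ_objMk₁_of_le i j h
  · rw [Fin.predAbove_of_castSucc_lt _ _ h]
    exact SSet.stdSimplex.δ_objMk₁_of_lt i j h

/-- The index of a simplex of `Δ[1]`, inverse to `SSet.stdSimplex.objMk₁`. -/
noncomputable def index {m : ℕ} : (Δ[1] : SSet.{0}) _⦋m⦌ ≃ Fin (m + 2) :=
  (Equiv.ofBijective _ SSet.stdSimplex.objMk₁_bijective).symm

lemma objMk₁_index {m : ℕ} (a : (Δ[1] : SSet.{0}) _⦋m⦌) :
    SSet.stdSimplex.objMk₁ (index a) = a :=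
  (Equiv.ofBijective _ SSet.stdSimplex.objMk₁_bijective).apply_symm_apply a

lemma index_objMk₁ {m : ℕ} (i : Fin (m + 2)) :
    index (SSet.stdSimplex.objMk₁ i) = i :=
  (Equiv.ofBijective _ SSet.stdSimplex.objMk₁_bijective).symm_apply_apply i

lemma eq_one_of_mem_boundary {m : ℕ} {H : Type} [Group H] (f : Fin (m + 2) → H) (h0 : f 0 = 1)
    (h1 : f (Fin.last _) = 1) (a : (Δ[1] : SSet.{0}) _⦋m⦌)
    (ha : a ∈ (SSet.boundary.{0} 1).obj (op ⦋m⦌)) : f (index a) = 1 := by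
  rw [← objMk₁_index a, objMk₁_mem_boundary] at ha
  rcases ha with h | h <;> rw [h] <;> assumption

/-- The homomorphism out of `F(S¹)_m` with prescribed values on the generators `x i`. -/
noncomputable def lift {m : ℕ} {H : Type} [Group H] (f : Fin (m + 2) → H) (h0 : f 0 = 1)
    (h1 : f (Fin.last _) = 1) : FS1 _⦋m⦌ →* H :=
  QuotientGroup.lift _
    (FreeGroup.lift (Quot.lift (fun a => f (index a)) fun a b h =>
      (eq_one_of_mem_boundary f h0 h1 a h.1).trans (eq_one_of_mem_boundary f h0 h1 b h.2).symm))
    (by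
      refine Subgroup.normalClosure_le_normal (N := MonoidHom.ker _) ?_
      rintro _ rfl
      refine (FreeGroup.lift_apply_of ..).trans ?_
      refine eq_one_of_mem_boundary f h0 h1 _ ((SSet.boundary.{0} 1).map _ ?_)
      rw [SSet.boundary_obj_eq_univ 0 1]
      trivial)

@[simp]
lemma lift_x {m : ℕ} {H : Type} [Group H] (f : Fin (m + 2) → H) (h0 h1) (i : Fin (m + 2)) :
    lift f h0 h1 (x i) = f i := by
  refine (FreeGroup.lift_apply_of ..).trans ?_
  exact congrArg f (index_objMk₁ i)

lemma hom_ext {m : ℕ} {H : Type} [Group H] {f g : FS1 _⦋m⦌ →* H} (h : ∀ i, f (x i) = g (x i)) :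
    f = g := by
  refine QuotientGroup.monoidHom_ext _ (FreeGroup.ext_hom _ _ ?_)
  rintro ⟨a⟩
  have := h (index a)
  rw [x, objMk₁_index] at this
  exact this

/-- The generators `y` of `F(S¹)_m`, where `y k` stands for the element `y_{k-1}` of the usual
numbering `y_{-1}, y_0, …, y_{m-1}`: the elements `y_0, …, y_{m-1}` form a basis, and
`y_{-1} = (y_0 ⋯ y_{m-1})⁻¹`. -/
def y {m : ℕ} (k : Fin (m + 1)) : FS1 _⦋m⦌ := x k.castSucc * (x k.succ)⁻¹

lemma prod_y (m : ℕ) : (List.ofFn (y (m := m))).prod = 1 := by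
  have key : ∀ l (hl : l ≤ m + 1), (List.ofFn fun i : Fin l => y (m := m) ⟨i, by omega⟩).prod =
      (x ⟨l, by omega⟩)⁻¹ := by
    intro l
    induction l with
    | zero => intro _; simpa using x_eq_one _ (.inl rfl)
    | succ l ih =>
      intro hl
      rw [List.ofFn_succ', List.concat_eq_append, List.prod_append]
      have := ih (by omega)
      simp only [Fin.val_castSucc, Fin.val_last, List.prod_singleton]
      rw [this, y]
      exact inv_mul_cancel_left _ _
  refine (key (m + 1) le_rfl).trans ?_
  rw [x_eq_one ⟨m + 1, _⟩ (.inr rfl), inv_one]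

/-- The values of `σ_{k-1}` on the generators `x`; see `sigma_y_self`, `sigma_y_succ`,
`sigma_y_of_ne` for those on the `y`. -/
def sigmaFun {m : ℕ} (k : Fin m) (i : Fin (m + 2)) : FS1 _⦋m⦌ :=
  if i = k.succ.castSucc then
    x k.succ.succ * (x k.succ.castSucc)⁻¹ * x k.castSucc.castSucc
  else x i

/-- The values of the inverse of `σ_{k-1}` on the generators `x`. -/
def sigmaInvFun {m : ℕ} (k : Fin m) (i : Fin (m + 2)) : FS1 _⦋m⦌ :=
  if i = k.succ.castSucc then
    x k.castSucc.castSucc * (x k.succ.castSucc)⁻¹ * x k.succ.succ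
  else x i

/-- The endomorphism `σ_{k-1}`. -/
noncomputable def sigmaHom {m : ℕ} (k : Fin m) : FS1 _⦋m⦌ →* FS1 _⦋m⦌ :=
  lift (sigmaFun k)
    (by rw [sigmaFun, if_neg (by simp [Fin.ext_iff]), x_eq_one _ (.inl rfl)])
    (by rw [sigmaFun, if_neg (by simp [Fin.ext_iff]; omega), x_eq_one _ (.inr rfl)])

/-- The inverse of `σ_{k-1}`. -/
noncomputable def sigmaInvHom {m : ℕ} (k : Fin m) : FS1 _⦋m⦌ →* FS1 _⦋m⦌ :=
  lift (sigmaInvFun k)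
    (by rw [sigmaInvFun, if_neg (by simp [Fin.ext_iff]), x_eq_one _ (.inl rfl)])
    (by rw [sigmaInvFun, if_neg (by simp [Fin.ext_iff]; omega), x_eq_one _ (.inr rfl)])

lemma sigmaHom_x_self {m : ℕ} (k : Fin m) : sigmaHom k (x k.succ.castSucc) =
    x k.succ.succ * (x k.succ.castSucc)⁻¹ * x k.castSucc.castSucc := by
  rw [sigmaHom, lift_x, sigmaFun, if_pos rfl]

lemma sigmaHom_x_of_ne {m : ℕ} (k : Fin m) (i : Fin (m + 2)) (h : (i : ℕ) ≠ k + 1) :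
    sigmaHom k (x i) = x i := by
  rw [sigmaHom, lift_x, sigmaFun, if_neg (by simpa [Fin.ext_iff] using h)]

lemma sigmaInvHom_x_self {m : ℕ} (k : Fin m) : sigmaInvHom k (x k.succ.castSucc) =
    x k.castSucc.castSucc * (x k.succ.castSucc)⁻¹ * x k.succ.succ := by
  rw [sigmaInvHom, lift_x, sigmaInvFun, if_pos rfl]

lemma sigmaInvHom_x_of_ne {m : ℕ} (k : Fin m) (i : Fin (m + 2)) (h : (i : ℕ) ≠ k + 1) :
    sigmaInvHom k (x i) = x i := by
  rw [sigmaInvHom, lift_x, sigmaInvFun, if_neg (by simpa [Fin.ext_iff] using h)]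

lemma sigmaHom_comp_inv {m : ℕ} (k : Fin m) :
    (sigmaHom k).comp (sigmaInvHom k) = MonoidHom.id _ := by
  refine hom_ext fun i => ?_
  by_cases h : (i : ℕ) = k + 1
  · obtain rfl : i = k.succ.castSucc := Fin.ext (by simpa using h)
    simp only [MonoidHom.comp_apply, MonoidHom.id_apply, sigmaInvHom_x_self, map_mul, map_inv,
      sigmaHom_x_self, sigmaHom_x_of_ne k k.castSucc.castSucc (by simp),
      sigmaHom_x_of_ne k k.succ.succ (by simp)]
    group
  · simp [sigmaInvHom_x_of_ne k i h, sigmaHom_x_of_ne k i h]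

lemma sigmaInv_comp_sigmaHom {m : ℕ} (k : Fin m) :
    (sigmaInvHom k).comp (sigmaHom k) = MonoidHom.id _ := by
  refine hom_ext fun i => ?_
  by_cases h : (i : ℕ) = k + 1
  · obtain rfl : i = k.succ.castSucc := Fin.ext (by simpa using h)
    simp only [MonoidHom.comp_apply, MonoidHom.id_apply, sigmaInvHom_x_self, map_mul, map_inv,
      sigmaHom_x_self, sigmaInvHom_x_of_ne k k.castSucc.castSucc (by simp),
      sigmaInvHom_x_of_ne k k.succ.succ (by simp)]
    group
  · simp [sigmaInvHom_x_of_ne k i h, sigmaHom_x_of_ne k i h]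

/-- The automorphism `σ_{k-1}` of `F(S¹)_m`, for `0 ≤ k < m`. It is characterized by the lemmas
`sigma_y_self`, `sigma_y_succ` and `sigma_y_of_ne` below. -/
noncomputable def sigma {m : ℕ} (k : Fin m) : MulAut (FS1 _⦋m⦌) :=
  MonoidHom.toMulEquiv (sigmaHom k) (sigmaInvHom k) (sigmaInv_comp_sigmaHom k)
    (sigmaHom_comp_inv k)

lemma sigma_x_self {m : ℕ} (k : Fin m) : sigma k (x k.succ.castSucc) =
    x k.succ.succ * (x k.succ.castSucc)⁻¹ * x k.castSucc.castSucc :=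
  sigmaHom_x_self k

lemma sigma_x_of_ne {m : ℕ} (k : Fin m) (i : Fin (m + 2)) (h : (i : ℕ) ≠ k + 1) :
    sigma k (x i) = x i :=
  sigmaHom_x_of_ne k i h

lemma sigma_y_self {m : ℕ} (k : Fin m) : sigma k (y k.castSucc) = y k.succ := by
  have h : k.castSucc.succ = k.succ.castSucc := rfl
  rw [y, y, map_mul, map_inv, h, sigma_x_self, sigma_x_of_ne _ _ (by simp)]
  group

lemma sigma_y_succ {m : ℕ} (k : Fin m) :
    sigma k (y k.succ) = (y k.succ)⁻¹ * y k.castSucc * y k.succ := by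
  have h : k.castSucc.succ = k.succ.castSucc := rfl
  rw [y, y, map_mul, map_inv, h, sigma_x_self, sigma_x_of_ne _ _ (by simp)]
  group

lemma sigma_y_of_ne {m : ℕ} (k : Fin m) (j : Fin (m + 1)) (h : j ≠ k.castSucc)
    (h' : j ≠ k.succ) : sigma k (y j) = y j := by
  rw [Ne, Fin.ext_iff] at h h'
  simp only [Fin.val_castSucc, Fin.val_succ] at h h'
  rw [y, map_mul, map_inv, sigma_x_of_ne _ _ (by simpa using h'),
    sigma_x_of_ne _ _ (by simpa using h)]

/-- `x` with indices in `ℕ`. -/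
def xN (m i : ℕ) : FS1 _⦋m⦌ := if h : i < m + 2 then x ⟨i, h⟩ else 1

lemma x_eq_xN {m : ℕ} (i : Fin (m + 2)) : x i = xN m i := by simp [xN]

lemma sigma_xN {m : ℕ} (k : Fin m) (i : ℕ) : sigma k (xN m i) =
    if i = k + 1 then xN m (k + 2) * (xN m (k + 1))⁻¹ * xN m k else xN m i := by
  split_ifs with h
  · subst h
    have := sigma_x_self k
    simp only [x_eq_xN] at this
    exact this
  · by_cases hi : i < m + 2
    · simpa only [x_eq_xN] using sigma_x_of_ne k ⟨i, hi⟩ h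
    · simp [xN, hi]

lemma δ_xN {m : ℕ} (j : Fin (m + 2)) (i : ℕ) :
    FS1.δ j (xN (m + 1) i) = if i ≤ j then xN m i else xN m (i - 1) := by
  by_cases hi : i < m + 3
  · have := δ_x j ⟨i, hi⟩
    rw [x_eq_xN, x_eq_xN] at this
    rw [this]
    split_ifs with h
    · rw [Fin.predAbove_of_le_castSucc _ _ (by simpa [Fin.le_def] using h)]; rfl
    · rw [Fin.predAbove_of_castSucc_lt _ _ (by simpa [Fin.lt_def] using h)]; rfl
  · have h1 : ¬ i < m + 1 + 2 := by omega
    have h2 : ¬ i ≤ j := by omega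
    have h3 : ¬ i - 1 < m + 2 := by omega
    simp [xN, h1, h2, h3]

lemma aut_ext {m : ℕ} {f g : MulAut (FS1 _⦋m⦌)} (h : ∀ i, f (xN m i) = g (xN m i)) : f = g := by
  refine MulEquiv.toMonoidHom_injective (hom_ext fun i => ?_)
  rw [x_eq_xN]
  exact h i

/-- The action of the braid group `B_{m+1}` on `F(S¹)_m`; the generator with index `k` acts as
`σ_{k-1}`. -/
noncomputable def braidAut (m : ℕ) : BraidGroup (m + 1) →* MulAut (FS1 _⦋m⦌) :=
  BraidGroup.lift (fun k => sigma k)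
    (by
      intro i j h
      refine aut_ext fun l => ?_
      simp only [MulAut.mul_apply]
      have h1 : (i : ℕ) ≠ i + 2 := by omega
      rcases eq_or_ne l (i + 1) with hl | hl
      · subst hl
        simp [sigma_xN, ← h, h1]
      · rcases eq_or_ne l (i + 2) with hl' | hl'
        · subst hl'
          simp [sigma_xN, ← h, h1]
          group
        · simp [sigma_xN, ← h, hl, hl'])
    (by
      intro i j h
      refine aut_ext fun l => ?_
      simp only [MulAut.mul_apply]
      have h1 : (i : ℕ) ≠ j := by omega
      have h2 : (i : ℕ) + 1 ≠ j := by omega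
      have h3 : (i : ℕ) ≠ j + 1 := by omega
      have h4 : (j : ℕ) ≠ i + 1 := by omega
      have h5 : (j : ℕ) + 1 ≠ i := by omega
      rcases eq_or_ne l (i + 1) with hl | hl
      · subst hl
        simp [sigma_xN, h1, h2, h3]
      · rcases eq_or_ne l (j + 1) with hl' | hl'
        · subst hl'
          simp [sigma_xN, h1.symm, h4, h5]
        · simp [sigma_xN, hl, hl'])

lemma δ_sigma_lt {m : ℕ} (k : Fin m) (j : Fin (m + 2)) (h : (j : ℕ) ≤ k) (u : FS1 _⦋m + 1⦌) :
    FS1.δ j (sigma k.succ u) = sigma k (FS1.δ j u) := by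
  have : (FS1.δ j).hom.comp (sigma k.succ).toMonoidHom =
      (sigma k).toMonoidHom.comp (FS1.δ j).hom := by
    refine hom_ext fun i => ?_
    simp only [MonoidHom.comp_apply, MulEquiv.coe_toMonoidHom, x_eq_xN, sigma_xN, δ_xN]
    obtain ⟨i, hi⟩ := i
    by_cases h1 : i = (k + 1) + 1
    · subst h1
      simp only [Fin.val_succ, if_true, map_mul, map_inv, δ_xN]
      repeat' split
      all_goals first | omega | simp_all [sigma_xN]
    · simp only [Fin.val_succ, h1, if_false, δ_xN]
      repeat' split
      all_goals simp only [sigma_xN]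
      all_goals try split
      all_goals first | rfl | omega
  exact DFunLike.congr_fun this u

lemma δ_sigma_self {m : ℕ} (k : Fin (m + 1)) (u : FS1 _⦋m + 1⦌) :
    FS1.δ k.castSucc (sigma k u) = FS1.δ k.succ u := by
  have : (FS1.δ k.castSucc).hom.comp (sigma k).toMonoidHom = (FS1.δ k.succ).hom := by
    refine hom_ext fun i => ?_
    simp only [MonoidHom.comp_apply, MulEquiv.coe_toMonoidHom, x_eq_xN, sigma_xN, δ_xN]
    obtain ⟨i, hi⟩ := i
    by_cases h1 : i = k + 1
    · subst h1
      simp only [if_true, map_mul, map_inv, δ_xN, Fin.val_castSucc, Fin.val_succ]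
      repeat' split
      all_goals first | omega | simp_all
    · simp only [h1, if_false, δ_xN, Fin.val_castSucc, Fin.val_succ]
      repeat' split
      all_goals first | rfl | omega
  exact DFunLike.congr_fun this u

lemma δ_sigma_succ {m : ℕ} (k : Fin (m + 1)) (u : FS1 _⦋m + 1⦌) :
    FS1.δ k.succ (sigma k u) = FS1.δ k.castSucc u := by
  have : (FS1.δ k.succ).hom.comp (sigma k).toMonoidHom = (FS1.δ k.castSucc).hom := by
    refine hom_ext fun i => ?_
    simp only [MonoidHom.comp_apply, MulEquiv.coe_toMonoidHom, x_eq_xN, sigma_xN, δ_xN]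
    obtain ⟨i, hi⟩ := i
    by_cases h1 : i = k + 1
    · subst h1
      simp only [if_true, map_mul, map_inv, δ_xN, Fin.val_castSucc, Fin.val_succ]
      repeat' split
      all_goals first | omega | simp_all
    · simp only [h1, if_false, δ_xN, Fin.val_castSucc, Fin.val_succ]
      repeat' split
      all_goals first | rfl | omega
  exact DFunLike.congr_fun this u

lemma δ_sigma_gt {m : ℕ} (k : Fin m) (j : Fin (m + 2)) (h : (k : ℕ) + 1 < j)
    (u : FS1 _⦋m + 1⦌) :
    FS1.δ j (sigma k.castSucc u) = sigma k (FS1.δ j u) := by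
  have : (FS1.δ j).hom.comp (sigma k.castSucc).toMonoidHom =
      (sigma k).toMonoidHom.comp (FS1.δ j).hom := by
    refine hom_ext fun i => ?_
    simp only [MonoidHom.comp_apply, MulEquiv.coe_toMonoidHom, x_eq_xN, sigma_xN, δ_xN]
    obtain ⟨i, hi⟩ := i
    by_cases h1 : i = k + 1
    · subst h1
      simp only [Fin.val_castSucc, if_true, map_mul, map_inv, δ_xN]
      repeat' split
      all_goals first | omega | simp_all [sigma_xN]
    · simp only [Fin.val_castSucc, h1, if_false, δ_xN]
      repeat' split
      all_goals simp only [sigma_xN]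
      all_goals try split
      all_goals first | rfl | omega
  exact DFunLike.congr_fun this u

lemma sigma_mem_moore {m : ℕ} (k : Fin m) (u : FS1 _⦋m + 1⦌) :
    sigma k.succ u ∈ SimplicialGroup.moore FS1 (m + 1) ↔
      u ∈ SimplicialGroup.moore FS1 (m + 1) := by
  rw [SimplicialGroup.mem_moore_succ, SimplicialGroup.mem_moore_succ]
  have h1 : ∀ j : Fin (m + 1), (j : ℕ) < k →
      (FS1.δ j.succ (sigma k.succ u) = 1 ↔ FS1.δ j.succ u = 1) := by
    intro j hj
    rw [δ_sigma_lt k j.succ (by simpa using hj)]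
    exact map_eq_one_iff _ (sigma k).injective
  have h2 : ∀ j : Fin (m + 1), (k : ℕ) + 1 < j →
      (FS1.δ j.succ (sigma k.succ u) = 1 ↔ FS1.δ j.succ u = 1) := by
    intro j hj
    have hk : (k : ℕ) + 1 < m := by omega
    have := δ_sigma_gt ⟨k + 1, hk⟩ j.succ (by simpa using hj) u
    refine (Eq.congr_left this).trans ?_
    exact map_eq_one_iff _ (sigma _).injective
  have h3 := δ_sigma_self k.succ u
  have h4 := δ_sigma_succ k.succ u
  constructor <;> intro H j
  all_goals
    rcases lt_or_ge (j : ℕ) k with hj | hj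
    · first | (exact (h1 j hj).1 (H j)) | (exact (h1 j hj).2 (H j))
    rcases lt_or_ge ((k : ℕ) + 1) j with hj' | hj'
    · first | (exact (h2 j hj').1 (H j)) | (exact (h2 j hj').2 (H j))
    have : j = k.castSucc ∨ j = k.succ := by
      simp only [Fin.ext_iff, Fin.val_castSucc, Fin.val_succ]
      omega
    rcases this with rfl | rfl
  · exact h4.symm.trans (H k.succ)
  · exact h3.symm.trans (H k.castSucc)
  · exact h3.trans (H k.succ)
  · exact h4.trans (H k.castSucc)

lemma map_sigma_boundaries {m : ℕ} (k : Fin m) :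
    (SimplicialGroup.boundaries FS1 m).map (sigma k).toMonoidHom =
      SimplicialGroup.boundaries FS1 m := by
  ext v
  simp only [SimplicialGroup.boundaries, Subgroup.mem_map]
  constructor
  · rintro ⟨_, ⟨u, hu, rfl⟩, rfl⟩
    exact ⟨sigma k.succ u, (sigma_mem_moore k u).2 hu, δ_sigma_lt k 0 (by simp) u⟩
  · rintro ⟨u, hu, rfl⟩
    refine ⟨_, ⟨(sigma k.succ).symm u, (sigma_mem_moore k _).1 ?_, rfl⟩, ?_⟩
    · rwa [MulEquiv.apply_symm_apply]
    · refine (δ_sigma_lt k 0 (by simp) _).symm.trans ?_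
      rw [MulEquiv.apply_symm_apply]

lemma map_braidAut_boundaries {m : ℕ} (b : BraidGroup (m + 1)) :
    (SimplicialGroup.boundaries FS1 m).map (braidAut m b).toMonoidHom =
      SimplicialGroup.boundaries FS1 m := by
  let S : Subgroup (BraidGroup (m + 1)) :=
    { carrier := {b | (SimplicialGroup.boundaries FS1 m).map (braidAut m b).toMonoidHom =
        SimplicialGroup.boundaries FS1 m}
      one_mem' := by
        rw [Set.mem_ofPred_eq, map_one]
        exact Subgroup.map_id _
      mul_mem' := by
        intro b c hb hc
        rw [Set.mem_ofPred_eq] at hb hc ⊢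
        conv_rhs => rw [← hb, ← hc, Subgroup.map_map]
        rw [map_mul]
        rfl
      inv_mem' := by
        intro b hb
        rw [Set.mem_ofPred_eq] at hb ⊢
        conv_lhs => rw [← hb, Subgroup.map_map]
        have : ((braidAut m b⁻¹).toMonoidHom.comp (braidAut m b).toMonoidHom) =
            MonoidHom.id _ := by
          ext u
          simp
        rw [this, Subgroup.map_id] }
  refine PresentedGroup.generated_by _ S (fun k => ?_) b
  have h : braidAut m (PresentedGroup.of k) = sigma k := BraidGroup.lift_gen _ _ _ k
  change Subgroup.map (braidAut m (PresentedGroup.of k)).toMonoidHom _ = _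
  rw [h]
  exact map_sigma_boundaries (m := m) k

/-- The action of `B_{m+1}` on `F(S¹)_m / ℬ(F(S¹))_m` induced by its action on `F(S¹)_m`. -/
noncomputable instance (m : ℕ) :
    MulDistribMulAction (BraidGroup (m + 1)) (SimplicialGroup.modBoundaries FS1 m) where
  smul b := QuotientGroup.map _ _ (braidAut m b).toMonoidHom
    (Subgroup.map_le_iff_le_comap.1 (map_braidAut_boundaries b).le)
  one_smul := by
    rintro ⟨u⟩
    refine congrArg QuotientGroup.mk ?_
    simp
  mul_smul b c := by
    rintro ⟨u⟩
    refine congrArg QuotientGroup.mk ?_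
    simp
  smul_mul b u v := map_mul _ u v
  smul_one b := map_one _

lemma smul_mk {m : ℕ} (b : BraidGroup (m + 1)) (u : FS1 _⦋m⦌) :
    b • (QuotientGroup.mk u : SimplicialGroup.modBoundaries FS1 m) =
      QuotientGroup.mk (braidAut m b u) :=
  rfl

end FS1

end

/-! Write x_1 for `xN m 1`, so that y_{-1} = x_1⁻¹. The full twist on all strands but the first is a
pure braid acting on F(S¹)_m as conjugation by x_1⁻¹ (`braidAut_fullTwist`). In a free group x_1
generates its own centralizer, so whatever this twist fixes is a power of x_1.

Pure braids fix π_{n+1}: for a cycle z, a suitable simplex has `sigma k z` and z as its only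
possibly nontrivial faces, two positions apart, so by homotopy addition `sigma k z` is z⁻¹ modulo
boundaries (`sigma_mul_mem_boundaries`). Hence a braid acts on π_{n+1} through the sign of its
permutation.

Conversely, boundaries are cycles, so a braid fixing the class of u preserves every face of u
exactly. Since d_0 intertwines the braid actions, d_0 u is fixed by K_{n+1} in F(S¹)_n, where for n
≥ 2 only 1 is fixed (`eq_one_of_pure_fixed`). For K_{n+2} the other faces follow from d_{k+1} u =
d_k (`sigma k u`) and the normality of the pure braid group, so u is a cycle. For K_{n+1} one still
gets d_0 u = 1, but for j > 0 only that d_j u is a power of x_1. Multiplying u by a power of x_1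
kills d_1 u, and the simplicial identities then kill the remaining faces; that power is the factor
ℤ. -/

/-! ### Centralizers in free groups -/

/-- A commutative free group is cyclic. -/
lemma IsFreeGroup.exists_forall_mem_zpowers {G : Type*} [Group G] [IsFreeGroup G]
    (hG : ∀ a b : G, a * b = b * a) : ∃ t : G, ∀ a, a ∈ Subgroup.zpowers t := by
  obtain ⟨ι, ⟨b⟩⟩ := IsFreeGroup.nonempty_basis (G := G)
  have hsub : Subsingleton ι := by
    by_contra h
    rw [not_subsingleton_iff_nontrivial] at h
    obtain ⟨i, j, hij⟩ := exists_pair_ne ι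
    classical
    -- Two distinct basis elements can be sent to transpositions that do not commute.
    let f : ι → Equiv.Perm (Fin 3) := fun k => if k = i then Equiv.swap 0 1 else Equiv.swap 1 2
    have h1 := congrArg (b.lift f) (hG (b i) (b j))
    rw [map_mul, map_mul] at h1
    have h2 : ∀ k, b.lift f (b k) = f k := fun k => by simp
    rw [h2, h2] at h1
    simp only [f, if_true, if_neg hij.symm] at h1
    exact absurd h1 (by decide)
  rcases isEmpty_or_nonempty ι with h | ⟨⟨i⟩⟩
  · refine ⟨1, fun a => ?_⟩
    have : MonoidHom.id G = 1 := b.ext_hom _ _ fun i => h.elim i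
    exact ⟨0, by simpa using (DFunLike.congr_fun this a).symm⟩
  · refine ⟨b i, fun a => ?_⟩
    have hr : (zpowersHom G (b i)).comp (b.lift fun _ => Multiplicative.ofAdd 1) =
        MonoidHom.id G := b.ext_hom _ _ fun k => by
      obtain rfl := Subsingleton.elim i k
      simp
    exact ⟨_, DFunLike.congr_fun hr a⟩

/-- In a free group, an element on which some homomorphism to `ℤ` takes the value `1` generates
its own centralizer. -/
lemma IsFreeGroup.mem_zpowers_of_commute {G : Type*} [Group G] [IsFreeGroup G]
    (φ : G →* Multiplicative ℤ) {a v : G} (ha : φ a = Multiplicative.ofAdd 1)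
    (h : a * v = v * a) : v ∈ Subgroup.zpowers a := by
  let H := Subgroup.closure {a, v}
  have hc : ∀ p q : H, p * q = q * p := by
    have : IsMulCommutative H := Subgroup.isMulCommutative_closure (by
      rintro x (rfl | rfl) y (rfl | rfl)
      exacts [rfl, h, h.symm, rfl])
    exact fun p q => this.is_comm.comm p q
  -- By Nielsen–Schreier `H` is free; being commutative, it is cyclic. Then a = t^k and φ a = 1
  -- force k = ±1, so a generates `H` as well.
  obtain ⟨t, ht⟩ := IsFreeGroup.exists_forall_mem_zpowers hc
  obtain ⟨k, hk⟩ := ht ⟨a, Subgroup.subset_closure (by simp)⟩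
  obtain ⟨l, hl⟩ := ht ⟨v, Subgroup.subset_closure (by simp)⟩
  replace hk : (t : G) ^ k = a := congrArg Subtype.val hk
  replace hl : (t : G) ^ l = v := congrArg Subtype.val hl
  have h1 : k * Multiplicative.toAdd (φ t) = 1 := by
    rw [← hk, map_zpow] at ha
    simpa using congrArg Multiplicative.toAdd ha
  rcases Int.isUnit_iff.1 (IsUnit.of_mul_eq_one _ h1) with rfl | rfl
  · rw [zpow_one] at hk
    exact ⟨l, hk ▸ hl⟩
  · refine ⟨-l, ?_⟩
    simp only [← hk, ← hl]
    group

/-! ### The homotopy addition theorem for at most two nontrivial faces -/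

section

open CategoryTheory Opposite

namespace SimplicialGroup

variable (G : SimplicialObject GrpCat.{0})

lemma mem_cycles_succ {m : ℕ} (x : G.obj (op (.mk (m + 1)))) :
    x ∈ cycles G (m + 1) ↔ ∀ j : Fin (m + 2), G.δ j x = 1 := by
  simp [cycles, Subgroup.mem_iInf, MonoidHom.mem_ker]

lemma δ_σ_castSucc {m : ℕ} (i : Fin (m + 1)) (z : G.obj (op (.mk m))) :
    G.δ i.castSucc (G.σ i z) = z := by
  simpa using ConcreteCategory.congr_hom (G.δ_comp_σ_self (i := i)) z

lemma δ_σ_succ {m : ℕ} (i : Fin (m + 1)) (z : G.obj (op (.mk m))) :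
    G.δ i.succ (G.σ i z) = z := by
  simpa using ConcreteCategory.congr_hom (G.δ_comp_σ_succ (i := i)) z

lemma δ_σ_of_ne {m : ℕ} (i : Fin (m + 2)) (j : Fin (m + 3)) (h : j ≠ i.castSucc)
    (h' : j ≠ i.succ) {z : G.obj (op (.mk (m + 1)))} (hz : z ∈ cycles G (m + 1)) :
    G.δ j (G.σ i z) = 1 := by
  rw [mem_cycles_succ] at hz
  rcases lt_or_gt_of_ne h with hlt | hgt
  · obtain ⟨i, rfl⟩ : ∃ i' : Fin (m + 1), i = i'.succ :=
      Fin.exists_succ_eq_of_ne_zero (by rintro rfl; simp at hlt) |>.imp fun _ h => h.symm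
    obtain ⟨j, rfl⟩ : ∃ j' : Fin (m + 2), j = j'.castSucc :=
      ⟨⟨j, by rw [Fin.lt_def] at hlt; simp at hlt; omega⟩, rfl⟩
    have := ConcreteCategory.congr_hom (G.δ_comp_σ_of_le (i := j) (j := i) (by
      rw [Fin.lt_def] at hlt; rw [Fin.le_def]; simp at hlt ⊢; omega)) z
    simpa [hz j] using this
  · obtain ⟨j, rfl⟩ : ∃ j' : Fin (m + 2), j = j'.succ :=
      Fin.exists_succ_eq_of_ne_zero (by rintro rfl; simp at hgt) |>.imp fun _ h => h.symm
    have h2 : (i : ℕ) < j := by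
      rw [Fin.lt_def] at hgt
      rw [Ne, Fin.ext_iff] at h'
      simp at hgt h'
      omega
    obtain ⟨i, rfl⟩ : ∃ i' : Fin (m + 1), i = i'.castSucc := ⟨⟨i, by omega⟩, rfl⟩
    have := ConcreteCategory.congr_hom (G.δ_comp_σ_of_gt (i := j) (j := i) (by
      rw [Fin.lt_def]; simpa using h2)) z
    simpa [hz j] using this

/-- Since d_j d_0 = d_0 d_{j+1}. This is what lets faces be computed from classes modulo boundaries.
-/
lemma boundaries_le_cycles (m : ℕ) : boundaries G m ≤ cycles G m := by
  rcases m with _ | m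
  · exact le_top
  rintro _ ⟨u, hu, rfl⟩
  rw [SetLike.mem_coe, mem_moore_succ] at hu
  rw [mem_cycles_succ]
  intro j
  have := ConcreteCategory.congr_hom (G.δ_comp_δ (i := 0) (j := j) (Fin.zero_le _)) u
  simp only [ConcreteCategory.comp_apply, hu j, map_one] at this
  exact this.symm

/-- If only the `i`-th face of `w` is nontrivial, then it is a boundary. -/
lemma δ_mem_boundaries {m : ℕ} (i : Fin (m + 3)) (w : G.obj (op (.mk (m + 2))))
    (hc : G.δ i w ∈ cycles G (m + 1)) (hw : ∀ j, j ≠ i → G.δ j w = 1) :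
    G.δ i w ∈ boundaries G (m + 1) := by
  induction i using Fin.induction generalizing w with
  | zero => exact ⟨w, (mem_moore_succ G w).2 fun j => hw _ (Fin.succ_ne_zero j), rfl⟩
  | succ i ih =>
    -- The degenerate factor cancels the face at i + 1 and leaves its inverse at i, moving the
    -- nontrivial face one step towards d_0.
    have h0 : G.δ i.castSucc (w * G.σ i (G.δ i.succ w)⁻¹) = (G.δ i.succ w)⁻¹ := by
      rw [map_mul, δ_σ_castSucc, hw _ (by simp [Fin.ext_iff]), one_mul]
    rw [← inv_mem_iff, ← h0]
    refine ih _ (by rw [h0]; exact inv_mem hc) fun j hj => ?_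
    rw [map_mul]
    rcases eq_or_ne j i.succ with rfl | hj'
    · rw [δ_σ_succ, mul_inv_cancel]
    · rw [hw j hj', one_mul, δ_σ_of_ne G i j hj hj' (inv_mem hc)]

/-- If only the faces `i` and `i + 2` of `w` are nontrivial, then they are inverse to each other
modulo boundaries. -/
lemma δ_mul_δ_mem_boundaries {m : ℕ} (i : Fin (m + 1)) (w : G.obj (op (.mk (m + 2))))
    (hc : G.δ i.castSucc.castSucc w ∈ cycles G (m + 1))
    (hc' : G.δ i.succ.succ w ∈ cycles G (m + 1))
    (hw : ∀ j, j ≠ i.castSucc.castSucc → j ≠ i.succ.succ → G.δ j w = 1) :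
    G.δ i.castSucc.castSucc w * G.δ i.succ.succ w ∈ boundaries G (m + 1) := by
  have e : i.succ.castSucc = i.castSucc.succ := rfl
  set a := G.δ i.castSucc.castSucc w with ha
  set b := G.δ i.succ.succ w with hb
  -- The factor with b⁻¹ cancels the face i + 2 and creates b⁻¹ at i + 1; the factor with b cancels
  -- that and adds b at i. Only the face a * b at i survives.
  have h0 : G.δ i.castSucc.castSucc (w * G.σ i.succ b⁻¹ * G.σ i.castSucc b) = a * b := by
    rw [map_mul, map_mul, ← ha, δ_σ_castSucc,
      δ_σ_of_ne G i.succ _ (by simp [Fin.ext_iff]) (by simp [Fin.ext_iff]; omega) (inv_mem hc'),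
      mul_one]
  rw [← h0]
  refine δ_mem_boundaries G _ _ (by rw [h0]; exact mul_mem hc hc') fun j hj => ?_
  rw [map_mul, map_mul]
  rcases eq_or_ne j i.castSucc.succ with rfl | hj1
  · rw [δ_σ_succ, hw _ hj (by simp [Fin.ext_iff]), ← e, δ_σ_castSucc]
    simp
  · rw [δ_σ_of_ne G i.castSucc _ hj hj1 hc', mul_one]
    rcases eq_or_ne j i.succ.succ with rfl | hj2
    · rw [← hb, δ_σ_succ, mul_inv_cancel]
    · rw [hw j hj hj2, δ_σ_of_ne G i.succ _ hj1 hj2 (inv_mem hc'), one_mul]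

lemma homotopyIncl_injective (m : ℕ) : Function.Injective (homotopyIncl G m) := by
  rw [injective_iff_map_eq_one]
  rintro ⟨z⟩ hz
  exact (QuotientGroup.eq_one_iff _).2 (Subgroup.mem_subgroupOf.2 ((QuotientGroup.eq_one_iff _).1 hz))

lemma mk_mem_range_homotopyIncl {m : ℕ} (u : G.obj (op (.mk m))) :
    (QuotientGroup.mk u : modBoundaries G m) ∈ (homotopyIncl G m).range ↔ u ∈ cycles G m := by
  constructor
  · rintro ⟨⟨z⟩, hz⟩
    have h : (z : G.obj (op (.mk m)))⁻¹ * u ∈ boundaries G m := QuotientGroup.eq.1 hz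
    simpa using mul_mem z.2 (boundaries_le_cycles G m h)
  · exact fun h => ⟨QuotientGroup.mk ⟨u, h⟩, rfl⟩

end SimplicialGroup

end

/-! ### Generators, full twists and permutations in braid groups -/

namespace BraidGroup

@[elab_as_elim]
lemma induction_gen {m : ℕ} {p : BraidGroup m → Prop} (b : BraidGroup m) (one : p 1)
    (gen : ∀ i, p (gen i)) (mul : ∀ a b, p a → p b → p (a * b)) (inv : ∀ a, p a → p a⁻¹) : p b :=
  PresentedGroup.generated_by _
    { carrier := {b | p b}, one_mem' := one, mul_mem' := mul _ _, inv_mem' := inv _ } gen b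

@[simp]
lemma toPerm_gen {m : ℕ} (i : Fin (m - 1)) :
    toPerm m (gen i) = Equiv.swap ⟨i, by omega⟩ ⟨i + 1, by omega⟩ :=
  lift_gen ..

@[simp]
lemma shift_gen {m : ℕ} (i : Fin (m - 1)) :
    shift m (gen i) = gen (m := m + 1) ⟨i + 1, by omega⟩ :=
  lift_gen ..

/-- The product of the first `l` generators. -/
def prodGen (m : ℕ) : ℕ → BraidGroup m
  | 0 => 1
  | l + 1 => prodGen m l * if h : l < m - 1 then gen ⟨l, h⟩ else 1

/-- The product of all the generators. -/
def rotation (m : ℕ) : BraidGroup m := prodGen m (m - 1)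

/-- For `l = m - 1` this is the m-cycle i ↦ i + 1, which is why `rotation m ^ m` is pure. -/
lemma toPerm_prodGen {m l : ℕ} (hl : l ≤ m - 1) (i : Fin m) :
    (toPerm m (prodGen m l) i : ℕ) =
      if (i : ℕ) < l then (i : ℕ) + 1 else if (i : ℕ) = l then 0 else (i : ℕ) := by
  induction l generalizing i with
  | zero =>
    simp only [prodGen, map_one, Equiv.Perm.one_apply]
    split_ifs <;> omega
  | succ l ih =>
    rw [prodGen, dif_pos (by omega), map_mul, Equiv.Perm.mul_apply, ih (by omega), toPerm_gen]
    simp only [Equiv.swap_apply_def, Fin.ext_iff]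
    grind

lemma toPerm_rotation_pow {m : ℕ} (l : ℕ) (i : Fin m) :
    (toPerm m (rotation m ^ l) i : ℕ) = (i + l) % m := by
  induction l with
  | zero => simp [Nat.mod_eq_of_lt i.2]
  | succ l ih =>
    rw [pow_succ', map_mul, Equiv.Perm.mul_apply, rotation, toPerm_prodGen le_rfl, ← rotation, ih]
    have hm : 0 < m := i.pos
    have h1 := Nat.mod_lt ((i : ℕ) + l) hm
    rw [← add_assoc, Nat.add_mod (i + l) 1]
    rcases Nat.lt_or_ge ((i + l) % m + 1) m with h | h
    · rw [if_pos (by omega), Nat.mod_eq_of_lt (a := 1) (by omega), Nat.mod_eq_of_lt h]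
    · have h2 : (i + l) % m + 1 = m := by omega
      rw [if_neg (by omega), if_pos (by omega), Nat.add_mod_mod, h2, Nat.mod_self]

lemma rotation_pow_mem_pure (m : ℕ) : rotation m ^ m ∈ pure m := by
  refine MonoidHom.mem_ker.2 (Equiv.ext fun i => Fin.ext ?_)
  rw [toPerm_rotation_pow]
  simp [Nat.mod_eq_of_lt i.2]

lemma toPerm_shift_zero {m : ℕ} (b : BraidGroup m) : toPerm (m + 1) (shift m b) 0 = 0 := by
  induction b using induction_gen with
  | one => simp
  | gen i =>
    rw [shift_gen, toPerm_gen, Equiv.swap_apply_of_ne_of_ne] <;> simp [Fin.ext_iff]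
  | mul a b ha hb => rw [map_mul, map_mul, Equiv.Perm.mul_apply, hb, ha]
  | inv a ha => rw [map_inv, map_inv, Equiv.Perm.inv_eq_iff_eq, ha]

lemma toPerm_shift_succ {m : ℕ} (b : BraidGroup m) (i : Fin m) :
    toPerm (m + 1) (shift m b) i.succ = (toPerm m b i).succ := by
  induction b using induction_gen generalizing i with
  | one => simp
  | gen k =>
    rw [shift_gen, toPerm_gen, toPerm_gen]
    simp only [Equiv.swap_apply_def, Fin.ext_iff, Fin.val_succ]
    split_ifs <;> simp_all
  | mul a b ha hb => rw [map_mul, map_mul, map_mul, Equiv.Perm.mul_apply, hb, ha]; rfl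
  | inv a ha =>
    rw [map_inv, map_inv, map_inv, Equiv.Perm.inv_eq_iff_eq, ha]
    simp

lemma shift_mem_pure {m : ℕ} {b : BraidGroup m} (hb : b ∈ pure m) :
    shift m b ∈ pure (m + 1) := by
  refine MonoidHom.mem_ker.2 (Equiv.ext fun i => ?_)
  induction i using Fin.cases with
  | zero => exact toPerm_shift_zero b
  | succ i => rw [toPerm_shift_succ, MonoidHom.mem_ker.1 hb]; rfl

/-- The set of points fixed by the pure braid group is invariant under the braid group. -/
lemma map_smul_map_smul_of_mem_pure {m : ℕ} {H α : Type*} [Group H] [MulAction H α]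
    (f : BraidGroup m →* H) {a : α} (ha : ∀ b ∈ pure m, f b • a = a) (c : BraidGroup m) :
    ∀ b ∈ pure m, f b • f c • a = f c • a := by
  intro b hb
  have hn : (pure m).Normal := MonoidHom.normal_ker _
  have h := ha _ (hn.conj_mem b hb c⁻¹)
  rwa [inv_inv, map_mul, map_mul, map_inv, mul_smul, mul_smul, inv_smul_eq_iff] at h

end BraidGroup

section

open CategoryTheory Opposite Simplicial

namespace FS1

/-! ### The free basis of `F(S¹)_m` -/

/-- The basis `x₁, …, x_m` of `F(S¹)_m`. -/
noncomputable def basis (m : ℕ) : FreeGroupBasis (Fin m) (FS1 _⦋m⦌) where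
  repr := MonoidHom.toMulEquiv
    -- Truncated subtraction sends 0 to 0, so `i = 0` is excluded separately; `i = m + 1` fails the
    -- first condition.
    (lift (fun i => if h : (i : ℕ) - 1 < m ∧ 0 < (i : ℕ) then FreeGroup.of ⟨i - 1, h.1⟩ else 1)
      (by simp) (by simp))
    (FreeGroup.lift fun i => x i.succ.castSucc)
    (by
      refine hom_ext fun i => ?_
      rw [MonoidHom.comp_apply, lift_x, MonoidHom.id_apply]
      split_ifs with h
      · rw [FreeGroup.lift_apply_of]
        congr 1
        ext
        simp
        omega
      · rw [map_one, x_eq_one]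
        simp only [Fin.ext_iff, Fin.val_last, Fin.val_zero]
        omega)
    (by
      ext i
      simp)

instance (m : ℕ) : IsFreeGroup (FS1 _⦋m⦌) := (basis m).isFreeGroup

/-- The exponent sum of `x_{k+1}` in an element of `F(S¹)_m`. -/
noncomputable def expSum {m : ℕ} (k : Fin m) : FS1 _⦋m⦌ →* Multiplicative ℤ :=
  lift (fun i => if (i : ℕ) = k + 1 then Multiplicative.ofAdd 1 else 1) (by simp)
    (by simp; omega)

lemma expSum_xN {m : ℕ} (k : Fin m) (i : ℕ) :
    expSum k (xN m i) = if i = k + 1 then Multiplicative.ofAdd 1 else 1 := by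
  by_cases h : i < m + 2
  · rw [← x_eq_xN ⟨i, h⟩, expSum, lift_x]
  · rw [xN, dif_neg h, map_one, if_neg (by omega)]

lemma xN_zero (m : ℕ) : xN m 0 = 1 := by
  rw [← x_eq_one (m := m) 0 (.inl rfl), x_eq_xN]; rfl

lemma xN_succ_self (m : ℕ) : xN m (m + 1) = 1 := by
  rw [← x_eq_one (m := m) (Fin.last _) (.inr rfl), x_eq_xN]; rfl

lemma y_zero (m : ℕ) : y (0 : Fin (m + 1)) = (xN m 1)⁻¹ := by
  rw [y, x_eq_xN, x_eq_xN]
  simp [xN_zero]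

lemma mem_zpowers_xN_one {m : ℕ} (hm : 1 ≤ m) {v : FS1 _⦋m⦌} (h : xN m 1 * v = v * xN m 1) :
    v ∈ Subgroup.zpowers (xN m 1) :=
  IsFreeGroup.mem_zpowers_of_commute (expSum ⟨0, hm⟩) (by simp [expSum_xN]) h

/-! ### The braid group action on generators -/

@[simp]
lemma braidAut_gen {m : ℕ} (k : Fin m) : braidAut m (BraidGroup.gen k) = sigma k :=
  BraidGroup.lift_gen (m := m + 1) _ _ _ k

/-- Each shifted generator changes a single x_i, with i ≥ 2. -/
lemma braidAut_shift_xN_one {m : ℕ} (b : BraidGroup m) :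
    braidAut m (BraidGroup.shift m b) (xN m 1) = xN m 1 := by
  induction b using BraidGroup.induction_gen with
  | one => simp
  | gen k =>
    rw [BraidGroup.shift_gen]
    refine (DFunLike.congr_fun (braidAut_gen (m := m) ⟨k + 1, by omega⟩) _).trans ?_
    rw [sigma_xN, if_neg (by simp)]
  | mul a b ha hb => rw [map_mul, map_mul, MulAut.mul_apply, hb, ha]
  | inv a ha => rw [map_inv, map_inv, MulAut.inv_apply, MulEquiv.symm_apply_eq, ha]

lemma braidAut_shift_prodGen_xN {m l : ℕ} (hl : l ≤ m - 1) (i : ℕ) :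
    braidAut m (BraidGroup.shift m (BraidGroup.prodGen m l)) (xN m i) =
      if 1 ≤ i ∧ i ≤ l + 1 then xN m (i + 1) * (xN m 2)⁻¹ * xN m 1 else xN m i := by
  induction l generalizing i with
  | zero =>
    simp only [BraidGroup.prodGen, map_one, MulAut.one_apply]
    split_ifs with h
    · obtain rfl : i = 1 := by omega
      simp
    · rfl
  | succ l ih =>
    rw [BraidGroup.prodGen, dif_pos (by omega), map_mul, map_mul, MulAut.mul_apply,
      BraidGroup.shift_gen]
    have h1 := sigma_xN (m := m) ⟨l + 1, by omega⟩ i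
    rw [← braidAut_gen] at h1
    refine (congrArg _ h1).trans ?_
    simp only
    by_cases hi : i = l + 1 + 1
    · subst hi
      rw [if_pos rfl, map_mul, map_mul, map_inv, ih (by omega), ih (by omega), ih (by omega),
        if_neg (by omega), if_neg (by omega), if_pos (by omega), if_pos (by omega)]
      group
    · rw [if_neg hi, ih (by omega)]
      congr 1
      simp only [eq_iff_iff]
      omega

lemma braidAut_rotation_xN {m i : ℕ} (hi : 1 ≤ i) (hi' : i ≤ m) :
    braidAut m (BraidGroup.shift m (BraidGroup.rotation m)) (xN m i) =
      xN m (i + 1) * (xN m 2)⁻¹ * xN m 1 := by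
  rw [BraidGroup.rotation, braidAut_shift_prodGen_xN le_rfl, if_pos (by omega)]

/-- In x_i x_{i+1}⁻¹ the common right factor produced by the rotation cancels, so each application
merely raises the index by one, as long as it does not pass m. -/
lemma braidAut_rotation_pow_y {m i l : ℕ} (hi : 1 ≤ i) (hi' : i + l ≤ m) :
    braidAut m (BraidGroup.shift m (BraidGroup.rotation m) ^ l) (xN m i * (xN m (i + 1))⁻¹) =
      xN m (i + l) * (xN m (i + l + 1))⁻¹ := by
  induction l with
  | zero => simp
  | succ l ih =>
    rw [pow_succ', map_mul (braidAut m), MulAut.mul_apply, ih (by omega), map_mul, map_inv,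
      braidAut_rotation_xN (by omega) (by omega), braidAut_rotation_xN (by omega) (by omega)]
    simp only [← add_assoc]
    group

/-- The full twist on all the strands but the first one acts by conjugation. -/
lemma braidAut_fullTwist {m : ℕ} (u : FS1 _⦋m⦌) :
    braidAut m (BraidGroup.shift m (BraidGroup.rotation m ^ m)) u =
      (xN m 1)⁻¹ * u * xN m 1 := by
  set ρ := BraidGroup.shift m (BraidGroup.rotation m) with hρ
  have hfix : ∀ l, braidAut m (ρ ^ l) (xN m 1) = xN m 1 := fun l => by
    rw [hρ, ← map_pow, braidAut_shift_xN_one]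
  have hy : ∀ i, 1 ≤ i → i ≤ m → braidAut m (ρ ^ m) (xN m i * (xN m (i + 1))⁻¹) =
      (xN m 1)⁻¹ * (xN m i * (xN m (i + 1))⁻¹) * xN m 1 := by
    intro i hi hi'
    -- The first m - i rotations bring x_i x_{i+1}⁻¹ to x_m, the next one wraps it to x_2⁻¹ x_1, the
    -- conjugate x_1⁻¹ (x_1 x_2⁻¹) x_1, and the last i - 1 carry x_1 x_2⁻¹ back to x_i x_{i+1}⁻¹
    -- while fixing x_1.
    have h1 : ρ ^ m = ρ ^ (i - 1) * (ρ * ρ ^ (m - i)) := by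
      rw [← pow_succ', ← pow_add]
      congr 1
      omega
    have h2 := braidAut_rotation_pow_y (m := m) (i := 1) (l := i - 1) le_rfl (by omega)
    rw [← hρ, show 1 + (i - 1) = i by omega, show 1 + 1 = 2 from rfl, map_mul, hfix, map_inv] at h2
    rw [h1, map_mul (braidAut m), MulAut.mul_apply, map_mul (braidAut m), MulAut.mul_apply, hρ,
      braidAut_rotation_pow_y hi (by omega), ← hρ, show i + (m - i) = m by omega, xN_succ_self,
      inv_one, mul_one, hρ, braidAut_rotation_xN (by omega) le_rfl, xN_succ_self, ← hρ, one_mul,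
      map_mul, map_inv, hfix, ← h2]
    group
  have hx : ∀ i, braidAut m (ρ ^ m) (xN m i) = (xN m 1)⁻¹ * xN m i * xN m 1 := by
    intro i
    induction i with
    | zero => simp [xN_zero]
    | succ i ih =>
      rcases Nat.lt_or_ge m (i + 1) with h | h
      · have : xN m (i + 1) = 1 := by
          rcases eq_or_ne i m with rfl | h'
          · exact xN_succ_self _
          · rw [xN, dif_neg (by omega)]
        rw [this, map_one]
        group
      rcases Nat.eq_zero_or_pos i with rfl | hi
      · rw [zero_add, hfix]
        group
      · have := hy i hi (by omega)
        rw [map_mul, ih, map_inv] at this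
        rw [← inv_inj, eq_inv_mul_of_mul_eq this]
        group
  rw [map_pow]
  have : (braidAut m (ρ ^ m)).toMonoidHom = (MulAut.conj (xN m 1)⁻¹).toMonoidHom := by
    refine hom_ext fun i => ?_
    rw [x_eq_xN]
    simpa using hx i
  simpa using DFunLike.congr_fun this u

end FS1

end

section

open CategoryTheory Opposite Simplicial

namespace FS1

open SimplicialGroup

/-! ### The braid group acts on `π_{m+1}` by signs -/

lemma δ_sigma_eq_one {m : ℕ} (k : Fin (m + 1)) (j : Fin (m + 2)) (h : j ≠ k.castSucc)
    (h' : j ≠ k.succ) {u : FS1 _⦋m + 1⦌} (hu : FS1.δ j u = 1) : FS1.δ j (sigma k u) = 1 := by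
  simp only [Ne, Fin.ext_iff, Fin.val_castSucc, Fin.val_succ] at h h'
  rcases Nat.lt_or_ge j k with hlt | hge
  · obtain ⟨k, rfl⟩ : ∃ k' : Fin m, k'.succ = k :=
      Fin.exists_succ_eq_of_ne_zero (by rintro rfl; simp at hlt)
    rw [δ_sigma_lt k j (by simp at hlt; omega), hu, map_one]
  · obtain ⟨k, rfl⟩ : ∃ k' : Fin m, k'.castSucc = k := ⟨⟨k, by omega⟩, rfl⟩
    simp only [Fin.val_castSucc] at h h' hge
    rw [δ_sigma_gt k j (by omega), hu, map_one]

lemma sigma_mem_cycles {m : ℕ} (k : Fin (m + 1)) {z : FS1 _⦋m + 1⦌}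
    (hz : z ∈ cycles FS1 (m + 1)) : sigma k z ∈ cycles FS1 (m + 1) := by
  rw [mem_cycles_succ] at hz ⊢
  intro j
  rcases eq_or_ne j k.castSucc with rfl | h
  · rw [δ_sigma_self, hz]
  rcases eq_or_ne j k.succ with rfl | h'
  · rw [δ_sigma_succ, hz]
  exact δ_sigma_eq_one k j h h' (hz j)

lemma sigma_mul_mem_boundaries {m : ℕ} (k : Fin (m + 1)) {z : FS1 _⦋m + 1⦌}
    (hz : z ∈ cycles FS1 (m + 1)) : sigma k z * z ∈ boundaries FS1 (m + 1) := by
  -- The degeneracy of z has the face z at k and k + 1 only. Applying `sigma k.succ` swaps the faces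
  -- k + 1 and k + 2 and acts as `sigma k` on the face k.
  have h1 : FS1.δ k.castSucc.castSucc (sigma k.succ (FS1.σ k.castSucc z)) = sigma k z := by
    rw [δ_sigma_lt k k.castSucc.castSucc (by simp), δ_σ_castSucc]
  have h2 : FS1.δ k.succ.succ (sigma k.succ (FS1.σ k.castSucc z)) = z := by
    rw [δ_sigma_succ]
    exact δ_σ_succ FS1 k.castSucc z
  have := δ_mul_δ_mem_boundaries FS1 k (sigma k.succ (FS1.σ k.castSucc z))
    (by rw [h1]; exact sigma_mem_cycles k hz) (by rw [h2]; exact hz) (fun j hj hj' => ?_)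
  · rwa [h1, h2] at this
  rcases eq_or_ne j k.succ.castSucc with rfl | h
  · rw [δ_sigma_self]
    exact δ_σ_of_ne FS1 k.castSucc _ (by simp [Fin.ext_iff]; omega) (by simp [Fin.ext_iff]) hz
  · exact δ_sigma_eq_one k.succ j h hj' (δ_σ_of_ne FS1 k.castSucc j hj h hz)

lemma gen_smul_of_mem_range {m : ℕ} (k : Fin (m + 1)) {q : modBoundaries FS1 (m + 1)}
    (hq : q ∈ (homotopyIncl FS1 (m + 1)).range) :
    (BraidGroup.gen k : BraidGroup (m + 1 + 1)) • q = q⁻¹ := by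
  obtain ⟨z, rfl⟩ := QuotientGroup.mk_surjective q
  rw [mk_mem_range_homotopyIncl] at hq
  rw [eq_inv_iff_mul_eq_one, smul_mk, braidAut_gen]
  exact (QuotientGroup.eq_one_iff _).2 (sigma_mul_mem_boundaries k hq)

lemma smul_of_mem_range {m : ℕ} (b : BraidGroup (m + 1 + 1)) {q : modBoundaries FS1 (m + 1)}
    (hq : q ∈ (homotopyIncl FS1 (m + 1)).range) :
    b • q = q ^ ((Equiv.Perm.sign (BraidGroup.toPerm _ b) : ℤˣ) : ℤ) := by
  have hpow : ∀ (c : BraidGroup (m + 1 + 1)) (l : ℤ), c • q ^ l = (c • q) ^ l := fun c l =>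
    map_zpow (MulDistribMulAction.toMonoidHom (modBoundaries FS1 (m + 1)) c) q l
  induction b using BraidGroup.induction_gen with
  | one => simp
  | gen k =>
    rw [gen_smul_of_mem_range k hq, BraidGroup.toPerm_gen,
      Equiv.Perm.sign_swap (by simp [Fin.ext_iff])]
    simp
  | mul a b ha hb =>
    rw [mul_smul, hb, hpow, ha, ← zpow_mul, map_mul, map_mul, Units.val_mul]
  | inv a ha =>
    rw [inv_smul_eq_iff, hpow, ha, ← zpow_mul, map_inv, map_inv, Units.mul_inv, zpow_one]

lemma smul_eq_self_of_mem_pure {m : ℕ} {b : BraidGroup (m + 1 + 1)}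
    (hb : b ∈ BraidGroup.pure (m + 1 + 1)) {q : modBoundaries FS1 (m + 1)}
    (hq : q ∈ (homotopyIncl FS1 (m + 1)).range) : b • q = q := by
  rw [smul_of_mem_range b hq, MonoidHom.mem_ker.1 hb]
  simp

/-! ### Faces of the elements fixed by pure braids -/

lemma δ_zero_braidAut_shift {m : ℕ} (b : BraidGroup (m + 1)) (u : FS1 _⦋m + 1⦌) :
    FS1.δ 0 (braidAut (m + 1) (BraidGroup.shift (m + 1) b) u) = braidAut m b (FS1.δ 0 u) := by
  induction b using BraidGroup.induction_gen generalizing u with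
  | one => simp
  | gen k =>
    rw [BraidGroup.shift_gen]
    refine (congrArg (fun f : MulAut _ => FS1.δ 0 (f u))
      (braidAut_gen (m := m + 1) (Fin.succ k))).trans ?_
    exact (δ_sigma_lt (m := m) k 0 (by simp) u).trans
      (DFunLike.congr_fun (braidAut_gen (m := m) k) _).symm
  | mul a b ha hb => simp only [map_mul, MulAut.mul_apply, ha, hb]
  | inv a ha =>
    rw [map_inv, map_inv, map_inv, MulAut.inv_apply, MulAut.inv_apply, MulEquiv.eq_symm_apply, ← ha,
      MulEquiv.apply_symm_apply]

/-- The first two generators mix d_1 with d_0 or d_2; the later ones pass through d_1 with index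
lowered by one. -/
lemma δ_one_braidAut_shift_shift {m : ℕ} (b : BraidGroup m) (u : FS1 _⦋m + 1⦌) :
    FS1.δ 1 (braidAut (m + 1) (BraidGroup.shift (m + 1) (BraidGroup.shift m b)) u) =
      braidAut m (BraidGroup.shift m b) (FS1.δ 1 u) := by
  induction b using BraidGroup.induction_gen generalizing u with
  | one => simp
  | gen k =>
    rw [BraidGroup.shift_gen, BraidGroup.shift_gen]
    let k' : Fin m := ⟨k + 1, by omega⟩
    refine (congrArg (fun f : MulAut _ => FS1.δ 1 (f u))
      (braidAut_gen (m := m + 1) k'.succ)).trans ?_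
    exact (δ_sigma_lt (m := m) k' 1 (by simp [k']) u).trans
      (DFunLike.congr_fun (braidAut_gen (m := m) k') _).symm
  | mul a b ha hb => simp only [map_mul, MulAut.mul_apply, ha, hb]
  | inv a ha =>
    rw [map_inv, map_inv, map_inv, map_inv, MulAut.inv_apply, MulAut.inv_apply,
      MulEquiv.eq_symm_apply, ← ha, MulEquiv.apply_symm_apply]

lemma δ_braidAut_of_smul_eq {m : ℕ} {b : BraidGroup (m + 1 + 1)} {u : FS1 _⦋m + 1⦌}
    (h : b • (QuotientGroup.mk u : modBoundaries FS1 (m + 1)) = QuotientGroup.mk u)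
    (j : Fin (m + 2)) : FS1.δ j (braidAut (m + 1) b u) = FS1.δ j u := by
  have h1 := (mem_cycles_succ FS1 _).1
    (boundaries_le_cycles FS1 _ (QuotientGroup.eq.1 ((smul_mk b u).symm.trans h))) j
  rwa [map_mul, map_inv, inv_mul_eq_one] at h1

lemma commute_xN_one_of_fullTwist {m : ℕ} {v : FS1 _⦋m⦌}
    (h : braidAut m (BraidGroup.shift m (BraidGroup.rotation m ^ m)) v = v) :
    xN m 1 * v = v * xN m 1 := by
  rw [braidAut_fullTwist, mul_assoc, inv_mul_eq_iff_eq_mul] at h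
  exact h.symm

/-- The pure braid group has no nontrivial fixed elements in `F(S¹)_m` for `m ≥ 2`. -/
lemma eq_one_of_pure_fixed {m : ℕ} (hm : 2 ≤ m) {v : FS1 _⦋m⦌}
    (hv : ∀ b ∈ BraidGroup.pure (m + 1), braidAut m b v = v) : v = 1 := by
  have key : ∀ w : FS1 _⦋m⦌, (∀ b ∈ BraidGroup.pure (m + 1), braidAut m b w = w) →
      w ∈ Subgroup.zpowers (xN m 1) := fun w hw =>
    mem_zpowers_xN_one (by omega) (commute_xN_one_of_fullTwist
      (hw _ (BraidGroup.shift_mem_pure (BraidGroup.rotation_pow_mem_pure m))))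
  obtain ⟨a, rfl⟩ := key v hv
  let s : BraidGroup (m + 1) := BraidGroup.gen ⟨0, by simp; omega⟩
  have hs : braidAut m s = sigma ⟨0, by omega⟩ := braidAut_gen (m := m) _
  -- The fixed set is stable under all braids, so the image (x_2 x_1⁻¹)^a is also a power of x_1.
  -- Its exponent sum in x_2, a basis element because m ≥ 2, is a; hence a = 0.
  obtain ⟨c, hc⟩ := key (braidAut m s (xN m 1 ^ a))
    (BraidGroup.map_smul_map_smul_of_mem_pure (braidAut m) hv s)
  have h2 := congrArg (fun t => Multiplicative.toAdd (expSum ⟨1, by omega⟩ t)) hc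
  simp [hs, sigma_xN, expSum_xN] at h2
  simp [← h2]

lemma δ_zero_eq_one {n : ℕ} (hn : 2 ≤ n) {u : FS1 _⦋n + 1⦌}
    (hu : ∀ b ∈ BraidGroup.pure (n + 1), BraidGroup.shift (n + 1) b •
      (QuotientGroup.mk u : modBoundaries FS1 (n + 1)) = QuotientGroup.mk u) :
    FS1.δ 0 u = 1 :=
  eq_one_of_pure_fixed hn fun b hb => by
    rw [← δ_zero_braidAut_shift, δ_braidAut_of_smul_eq (hu b hb)]

lemma mem_cycles_of_pure_fixed {n : ℕ} (hn : 2 ≤ n) {u : FS1 _⦋n + 1⦌}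
    (hu : ∀ b ∈ BraidGroup.pure (n + 2),
      b • (QuotientGroup.mk u : modBoundaries FS1 (n + 1)) = QuotientGroup.mk u) :
    u ∈ cycles FS1 (n + 1) := by
  rw [mem_cycles_succ]
  intro j
  induction j using Fin.induction generalizing u with
  | zero => exact δ_zero_eq_one hn fun b hb => hu _ (BraidGroup.shift_mem_pure hb)
  | succ k ih =>
    -- The face k + 1 of u is the face k of `sigma k u`, whose class is again fixed by the pure
    -- braids.
    rw [← δ_sigma_self]
    refine ih ?_
    have := BraidGroup.map_smul_map_smul_of_mem_pure (MonoidHom.id (BraidGroup (n + 2))) hu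
      (BraidGroup.gen k)
    rwa [MonoidHom.id_apply, smul_mk (m := n + 1), braidAut_gen (m := n + 1)] at this

lemma δ_succ_mem_zpowers {n : ℕ} (hn : 1 ≤ n) {u : FS1 _⦋n + 1⦌}
    (hu : ∀ b ∈ BraidGroup.pure (n + 1), BraidGroup.shift (n + 1) b •
      (QuotientGroup.mk u : modBoundaries FS1 (n + 1)) = QuotientGroup.mk u)
    (j : Fin (n + 1)) : FS1.δ j.succ u ∈ Subgroup.zpowers (xN n 1) := by
  induction j using Fin.induction generalizing u with
  | zero =>
    -- The twist on all strands but the first two acts on d_1 u as the full twist that conjugates by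
    -- x_1⁻¹.
    refine mem_zpowers_xN_one hn (commute_xN_one_of_fullTwist ?_)
    refine (δ_one_braidAut_shift_shift _ u).symm.trans (δ_braidAut_of_smul_eq (hu _ ?_) _)
    exact BraidGroup.shift_mem_pure (BraidGroup.rotation_pow_mem_pure n)
  | succ k ih =>
    rw [← δ_sigma_self]
    refine ih ?_
    have h1 : BraidGroup.shift (n + 1) (BraidGroup.gen k) •
        (QuotientGroup.mk u : modBoundaries FS1 (n + 1)) =
          QuotientGroup.mk (sigma k.succ u) := by
      rw [BraidGroup.shift_gen, smul_mk]
      exact congrArg (fun f : MulAut _ => QuotientGroup.mk (f u))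
        (braidAut_gen (m := n + 1) k.succ)
    rw [← h1]
    exact BraidGroup.map_smul_map_smul_of_mem_pure (BraidGroup.shift (n + 1)) hu _

lemma exists_zpow_mul_of_pure_fixed {n : ℕ} (hn : 2 ≤ n) {u : FS1 _⦋n + 1⦌}
    (hu : ∀ b ∈ BraidGroup.pure (n + 1), BraidGroup.shift (n + 1) b •
      (QuotientGroup.mk u : modBoundaries FS1 (n + 1)) = QuotientGroup.mk u) :
    ∃ k : ℤ, (xN (n + 1) 1) ^ k * u ∈ cycles FS1 (n + 1) := by
  obtain ⟨k, hk⟩ := δ_succ_mem_zpowers (by omega) hu 0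
  refine ⟨-k, ?_⟩
  have hu' : ∀ b ∈ BraidGroup.pure (n + 1), BraidGroup.shift (n + 1) b •
      (QuotientGroup.mk ((xN (n + 1) 1) ^ (-k) * u) : modBoundaries FS1 (n + 1)) =
        QuotientGroup.mk ((xN (n + 1) 1) ^ (-k) * u) := by
    intro b hb
    rw [QuotientGroup.mk_mul, smul_mul', hu b hb, smul_mk, map_zpow, braidAut_shift_xN_one]
  have h1 : FS1.δ 1 ((xN (n + 1) 1) ^ (-k) * u) = 1 := by
    rw [map_mul, map_zpow, δ_xN, if_pos (by simp), zpow_neg, inv_mul_eq_one]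
    exact hk
  have hx := δ_succ_mem_zpowers (by omega) hu'
  have h0 := δ_zero_eq_one hn hu'
  generalize (xN (n + 1) 1) ^ (-k) * u = w at *
  rw [mem_cycles_succ]
  intro j
  induction j using Fin.cases with
  | zero => exact h0
  | succ j =>
    obtain ⟨n, rfl⟩ : ∃ p, n = p + 1 := ⟨n - 1, by omega⟩
    induction j using Fin.cases with
    | zero => exact h1
    | succ j =>
      obtain ⟨l, hl⟩ := hx j.succ
      -- Here d_{j+2} w = x_1^l and d_1 d_{j+2} w = d_{j+1} d_1 w = 1. As d_1 x_1 = x_1, still a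
      -- basis element in degree n - 1 ≥ 1, this gives l = 0.
      have h2 := ConcreteCategory.congr_hom (FS1.δ_comp_δ (i := 1) (j := j.succ)
        (by simp [Fin.le_def])) w
      have h3 : FS1.δ (Fin.castSucc 1) w = 1 := h1
      simp only [ConcreteCategory.comp_apply, h3, map_one] at h2
      rw [← hl] at h2 ⊢
      have h4 := congrArg (expSum ⟨0, by omega⟩) h2
      simp [δ_xN, expSum_xN] at h4
      simp [h4]

/-! ### The fixed subgroups -/

/-- The full twist is pure, so it fixes π, yet it acts as conjugation by y_{-1} = x_1⁻¹. -/
lemma mk_y_zero_commute {m : ℕ} {q : modBoundaries FS1 (m + 1)}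
    (hq : q ∈ (homotopyIncl FS1 (m + 1)).range) :
    Commute (QuotientGroup.mk (y 0) : modBoundaries FS1 (m + 1)) q := by
  have h := smul_eq_self_of_mem_pure
    (BraidGroup.shift_mem_pure (BraidGroup.rotation_pow_mem_pure (m + 1))) hq
  obtain ⟨u, rfl⟩ := QuotientGroup.mk_surjective q
  rw [smul_mk, braidAut_fullTwist, mul_assoc, QuotientGroup.mk_mul, QuotientGroup.mk_inv,
    inv_mul_eq_iff_eq_mul, QuotientGroup.mk_mul] at h
  rw [y_zero, QuotientGroup.mk_inv]
  exact Commute.inv_left h.symm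

end FS1

end

theorem theorem2p11 (n : ℕ) (hn : 2 ≤ n) :
    Function.Injective (SimplicialGroup.homotopyIncl FS1 (n + 1)) ∧
    (∃ e : Multiplicative ℤ × SimplicialGroup.homotopyGroup FS1 (n + 1) ≃*
        FixedPoints.subgroup ((BraidGroup.pure (n + 1)).map (BraidGroup.shift (n + 1)))
          (SimplicialGroup.modBoundaries FS1 (n + 1)),
      ∀ (k : ℤ) (z : SimplicialGroup.homotopyGroup FS1 (n + 1)),
        (e (Multiplicative.ofAdd k, z) : SimplicialGroup.modBoundaries FS1 (n + 1)) =
          QuotientGroup.mk (FS1.y 0) ^ k * SimplicialGroup.homotopyIncl FS1 (n + 1) z) ∧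
    FixedPoints.subgroup (BraidGroup.pure (n + 2))
        (SimplicialGroup.modBoundaries FS1 (n + 1)) =
      (SimplicialGroup.homotopyIncl FS1 (n + 1)).range := by
  have hinj := SimplicialGroup.homotopyIncl_injective FS1 (n + 1)
  refine ⟨hinj, ?_, ?_⟩
  · let Y : SimplicialGroup.modBoundaries FS1 (n + 1) := QuotientGroup.mk (FS1.y 0)
    let ψ := (zpowersHom _ Y).noncommCoprod (SimplicialGroup.homotopyIncl FS1 (n + 1))
      fun k z => (FS1.mk_y_zero_commute ⟨z, rfl⟩).zpow_left k
    have hψ : ∀ k z, ψ (k, z) = Y ^ (Multiplicative.toAdd k) *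
      SimplicialGroup.homotopyIncl FS1 (n + 1) z := fun k z => rfl
    have hψ_inj : Function.Injective ψ := by
      rw [injective_iff_map_eq_one]
      rintro ⟨k, z⟩ h
      rw [hψ] at h
      have hk : Multiplicative.toAdd k = 0 := by
        have h1 : (QuotientGroup.mk (FS1.y 0 ^ Multiplicative.toAdd k) :
            SimplicialGroup.modBoundaries FS1 (n + 1)) ∈
              (SimplicialGroup.homotopyIncl FS1 (n + 1)).range :=
          ⟨z⁻¹, by rw [map_inv, ← eq_inv_of_mul_eq_one_left h]; rfl⟩
        rw [SimplicialGroup.mk_mem_range_homotopyIncl, SimplicialGroup.mem_cycles_succ] at h1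
        -- Since d_1 fixes y_{-1}, a power of y_{-1} that is a cycle has exponent 0.
        have h2 := congrArg (FS1.expSum ⟨0, by omega⟩) (h1 1)
        simpa [FS1.y_zero, FS1.δ_xN, FS1.expSum_xN] using h2
      rw [hk, zpow_zero, one_mul] at h
      exact Prod.ext hk (hinj (h.trans (map_one _).symm))
    have hrange : ψ.range = FixedPoints.subgroup
        ((BraidGroup.pure (n + 1)).map (BraidGroup.shift (n + 1)))
          (SimplicialGroup.modBoundaries FS1 (n + 1)) := by
      ext q
      constructor
      · rintro ⟨⟨k, z⟩, rfl⟩ ⟨_, b, hb, rfl⟩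
        change BraidGroup.shift (n + 1) b • ψ (k, z) = ψ (k, z)
        rw [hψ, smul_mul', FS1.smul_eq_self_of_mem_pure (BraidGroup.shift_mem_pure hb) ⟨z, rfl⟩]
        congr 1
        refine (FS1.smul_mk _ (FS1.y 0 ^ Multiplicative.toAdd k)).trans ?_
        rw [map_zpow, FS1.y_zero, map_inv, FS1.braidAut_shift_xN_one, ← FS1.y_zero]
        rfl
      · intro hq
        obtain ⟨u, rfl⟩ := QuotientGroup.mk_surjective q
        obtain ⟨k, hk⟩ := FS1.exists_zpow_mul_of_pure_fixed hn fun b hb => hq ⟨_, b, hb, rfl⟩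
        obtain ⟨z, hz⟩ := (SimplicialGroup.mk_mem_range_homotopyIncl FS1 _).2 hk
        -- As y_{-1} = x_1⁻¹, u is y_{-1}^k times the cycle x_1^k u.
        refine ⟨(Multiplicative.ofAdd k, z), ?_⟩
        rw [hψ, hz, toAdd_ofAdd, QuotientGroup.mk_mul, ← mul_assoc]
        refine mul_eq_right.2 ?_
        change QuotientGroup.mk (FS1.y 0 ^ k * FS1.xN (n + 1) 1 ^ k) = _
        rw [FS1.y_zero, inv_zpow, inv_mul_cancel]
        rfl
    exact ⟨(MonoidHom.ofInjective hψ_inj).trans (MulEquiv.subgroupCongr hrange), fun k z => rfl⟩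
  · ext q
    constructor
    · intro hq
      obtain ⟨u, rfl⟩ := QuotientGroup.mk_surjective q
      rw [SimplicialGroup.mk_mem_range_homotopyIncl]
      exact FS1.mem_cycles_of_pure_fixed hn fun b hb => hq ⟨b, hb⟩
    · exact fun hq b => FS1.smul_eq_self_of_mem_pure b.2 hq
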